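/- **Setting.** Let $M=(S,\mathit{Act},P,L)$ be a finite MDP with labelling $L:S\to 2^{AP}$, and consider the specification $$\exists(\hat\sigma_1\dots\hat\sigma_n).\ \mathcal Q_1\hat s_1\in I_1(\hat\sigma_{\beta(1)})\dots\mathcal Q_m\hat s_m\in I_m(\hat\sigma_{\beta(m)}).\ \mathbb P(\varphi)>\lambda ,$$ where $\mathcal Q_i\in\{\exists,\forall\}$, $I_i\subseteq S$, $\beta:\{1..m\}\to\{1..n\}$ binds agents to policy variables, $\lambda\in[0,1]$ and $\varphi$ is an LTL formula over propositions $p_j$ ($p\in AP$, $1\le j\le m$). Let $M^m$ be the $m$-fold self-composition (states $S^m$, actions $\mathit{Act}^m$, product transition probabilities, labels $L^m(\mathbf s)=(L(s_1),\dots,L(s_m))$). A tuple of memoryless policies $\sigma_v:S\to\mathit{Act}$ ($1\le v\le n$) *witnesses* the specification if $\mathcal Q_1s_1\in I_1\dots\mathcal Q_ms_m\in I_m$: the Markov chain on $M^m$ in which replica $i$ follows $\sigma_{\beta(i)}$, started in $(s_1,\dots,s_m)$, generates a trace satisfying $\varphi$ with probability $>\lambda$. Let $\mathcal A=(Q,(2^{AP})^m,\delta,q_0,\mathit{Acc})$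 be a deterministic Rabin automaton with finite $Q$ accepting exactly the traces that satisfy $\varphi$. The synchronised product $\mathcal D$ has states $S^m\times Q$ and actions $\mathit{Act}^m\times\{\alpha\}$; under $(\mathbf a,\alpha)$ it moves from $(\mathbf s,q)$ to $(\mathbf s',\delta(q,L^m(\mathbf s)))$ with probability $\prod_iP(s_i,a_i,s_i')$. For a memoryless policy $\bar\sigma$ of $\mathcal D$ let $U_{\bar\sigma}$ be the union of the bottom strongly connected components $C$ of the chain $\mathcal D^{\bar\sigma}$ that are accepting, i.e. for some $(L,K)\in\mathit{Acc}$ no state of $C$ has its automaton component in $L$ and some state of $C$ has it in $K$. The value $V(\bar\sigma)$ is the probability of reaching $U_{\bar\sigma}$ in $\mathcal D^{\bar\sigma}$ from $((s_1,\dots,s_m),q_0)$, maximised over $s_i\in I_i$ if $\mathcal Q_i=\exists$ and minimised if $\mathcal Q_i=\forall$, nested in the order of the quantifiers (an empty maximum is $0$, an empty minimum $+\infty$). A policy $\bar\sigma$ of $\mathcal D$ is *inconsistent* if there are agents $i,j$ (possibly equal) with $\beta(i)=\beta(j)$ and states $x,y$ of $\mathcal D$ in which agent $i$, resp. agent $j$,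 is in the same local state, while $\bar\sigma(x)(i)\ne\bar\sigma(y)(j)$. A policy tuple $(\sigma_v)$ *factorises* $\bar\sigma$ if $\bar\sigma((\mathbf s,q))(j)=\sigma_{\beta(j)}(s_j)$ always; it *resolves* $\bar\sigma$ if, whenever some agent is bound to $v$, each $\sigma_v(s)$ is one of the actions $\bar\sigma(x)(j)$ with $\beta(j)=v$ and agent $j$ in local state $s$ in $x$. Every tuple $(\sigma_v)$ defines the policy $(\mathbf s,q)\mapsto((\sigma_{\beta(j)}(s_j))_j,\alpha)$ of $\mathcal D$, and the tuple is called consistent if this policy is. **Algorithm.** A *submodel* restricts $\mathcal D$ by prescribing, for each state $x$ and agent $k$, a set $\mathit{Act}(x)(k)$ of allowed actions; its policies are the memoryless deterministic policies of $\mathcal D$ respecting these sets, and an optimal policy is one with maximal value $V$ among them. The algorithm keeps a collection of submodels, initially $\{\mathcal D\}$, and repeats the following; all choices are arbitrary. If the collection is empty, it stops and reports that there is no solution. Otherwise it removes a submodel $\mathcal D'$. If $\mathcal D'$ has no policy, it is discarded. Otherwise take an optimal policy $\bar\sigma$ of $\mathcal D'$. 1. If $V(\bar\sigma)\le\lambda$,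 discard $\mathcal D'$. 2. If $V(\bar\sigma)>\lambda$ and $\bar\sigma$ is consistent, stop and return a tuple that factorises $\bar\sigma$. 3. If $V(\bar\sigma)>\lambda$ and $\bar\sigma$ is inconsistent, choose a tuple that resolves $\bar\sigma$. If the policy of $\mathcal D$ it defines has value $>\lambda$, stop and return the tuple. Otherwise choose $i,j,x,y$ as in the definition of inconsistency, put $a=\bar\sigma(x)(i)$, $b=\bar\sigma(y)(j)$, let $s$ be the local state of agent $i$ in $x$, and replace $\mathcal D'$ by three submodels, which differ from $\mathcal D'$ exactly in that, for all agents $k$ with $\beta(k)=\beta(i)$ and all states $z$ in which $k$ is in local state $s$, the set $\mathit{Act}(z)(k)$ becomes $\{a\}$, $\{b\}$ and $\mathit{Act}(z)(k)\setminus\{a,b\}$, respectively. **Theorem.** Every run of the algorithm terminates. A run can stop only (it never gets stuck otherwise) by either returning a consistent tuple of memoryless policies $\sigma_1\dots\sigma_n$ that witnesses the specification, or reporting that there is no solution, in which case no tuple of memoryless policies witnesses the specification. -/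

import Mathlib

open scoped ENNReal

namespace PHLTL

noncomputable section

/-! ### Markov decision processes and Markov chains -/

/-- A Markov decision process with states `S`, actions `Act` and labels in `Lab`
(for an ordinary MDP over atomic propositions `AP`, the labels are `Lab = Set AP`). -/
structure MDP (S Act Lab : Type*) where
  P : S → Act → PMF S
  L : S → Lab

/-- The transition function of the Markov chain that a memoryless policy induces. -/
def MDP.induced {S Act Lab : Type*} (M : MDP S Act Lab) (σ : S → Act) : S → PMF S :=
  fun s => M.P s (σ s)

/-- The transition kernels of a Markov chain, seen as depending on the whole history:
the next state is distributed according to the last state of the history. -/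
def stepKernel {X : Type*} [MeasurableSpace X] [DiscreteMeasurableSpace X]
    (P : X → PMF X) (t : ℕ) :
    ProbabilityTheory.Kernel ((i : Finset.Iic t) → X) X where
  toFun h := (P (h ⟨t, Finset.mem_Iic.2 le_rfl⟩)).toMeasure
  measurable' :=
    (Measurable.of_discrete (f := fun x : X => (P x).toMeasure)).comp (measurable_pi_apply _)

instance {X : Type*} [MeasurableSpace X] [DiscreteMeasurableSpace X]
    (P : X → PMF X) (t : ℕ) : ProbabilityTheory.IsMarkovKernel (stepKernel P t) :=
  ⟨fun h => PMF.toMeasure.isProbabilityMeasure (P (h ⟨t, Finset.mem_Iic.2 le_rfl⟩))⟩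

/-- The law of the infinite paths, started in `x`, of the Markov chain with transition
function `P`. -/
def pathMeasure {X : Type*} [MeasurableSpace X] [DiscreteMeasurableSpace X]
    (P : X → PMF X) (x : X) : MeasureTheory.Measure (ℕ → X) :=
  ProbabilityTheory.Kernel.trajMeasure (X := fun _ => X)
    (MeasureTheory.Measure.dirac x) (stepKernel P)

/-- The probability that the path started in `x` belongs to `E`; the state space carries the
discrete σ-algebra. -/
def pathProb {X : Type*} (P : X → PMF X) (x : X) (E : Set (ℕ → X)) : ℝ≥0∞ :=
  letI : MeasurableSpace X := ⊤
  pathMeasure P x E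

/-- The probability of reaching `T` from `x`. -/
def reachProb {X : Type*} (P : X → PMF X) (x : X) (T : Set X) : ℝ≥0∞ :=
  pathProb P x {π | ∃ t, π t ∈ T}

/-- The `m`-self-composition of `M`. -/
def MDP.selfComp {S Act Lab : Type*} [Fintype S] (M : MDP S Act Lab) (m : ℕ) :
    MDP (Fin m → S) (Fin m → Act) (Fin m → Lab) where
  P s a := PMF.ofFintype (fun s' => ∏ i, M.P (s i) (a i) (s' i)) (by
    classical
    rw [← Fintype.prod_sum]
    refine Finset.prod_eq_one fun i _ => ?_
    have h := (M.P (s i) (a i)).tsum_coe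
    rwa [tsum_fintype] at h)
  L s := fun i => M.L (s i)

/-! ### Linear temporal logic and deterministic Rabin automata -/

/-- LTL formulae over propositions `p` tagged with the index `j` of a replica. -/
inductive LTL (AP : Type*) (m : ℕ) where
  | atom (p : AP) (j : Fin m) : LTL AP m
  | and (φ ψ : LTL AP m) : LTL AP m
  | neg (φ : LTL AP m) : LTL AP m
  | next (φ : LTL AP m) : LTL AP m
  | untl (φ ψ : LTL AP m) : LTL AP m

/-- The infinite trace `w` satisfies an LTL formula. -/
def LTL.Sat {AP : Type*} {m : ℕ} : LTL AP m → (ℕ → Fin m → Set AP) → Prop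
  | .atom p j, w => p ∈ w 0 j
  | .and φ ψ, w => φ.Sat w ∧ ψ.Sat w
  | .neg φ, w => ¬ φ.Sat w
  | .next φ, w => φ.Sat (fun t => w (1 + t))
  | .untl φ ψ, w =>
      ∃ j, ψ.Sat (fun t => w (j + t)) ∧ ∀ i < j, φ.Sat (fun t => w (i + t))

/-- Deterministic Rabin automata with states `Q` and alphabet `Γ`. -/
structure DRA (Q Γ : Type*) where
  δ : Q → Γ → Q
  q₀ : Q
  Acc : Set (Set Q × Set Q)

/-- The run of the automaton on an infinite word. -/
def DRA.run {Q Γ : Type*} (A : DRA Q Γ) (w : ℕ → Γ) : ℕ → Q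
  | 0 => A.q₀
  | t + 1 => A.δ (A.run w t) (w t)

/-- Rabin acceptance: for some pair `(L, K)` the run visits `L` only finitely often and `K`
infinitely often. -/
def DRA.Accepts {Q Γ : Type*} (A : DRA Q Γ) (w : ℕ → Γ) : Prop :=
  ∃ p ∈ A.Acc, {t | A.run w t ∈ p.1}.Finite ∧ {t | A.run w t ∈ p.2}.Infinite

/-! ### Formulae with one probability constraint -/

inductive Quant where
  | ex
  | all

/-- The formula
`∃ (σ₁ … σₙ). 𝒬₁ s₁ ∈ I₁(σ_{bind 1}) … 𝒬ₘ sₘ ∈ Iₘ(σ_{bind m}). ℙ(body) > threshold`. -/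
structure Formula (S AP : Type*) (n m : ℕ) where
  quant : Fin m → Quant
  I : Fin m → Set S
  bind : Fin m → Fin n
  body : LTL AP m
  threshold : unitInterval

/-- `𝒬₁ s₁ ∈ I₁ … 𝒬ₘ sₘ ∈ Iₘ. G (s₁, …, sₘ)`. -/
def quantify {S : Type*} : {m : ℕ} → (Fin m → Quant) → (Fin m → Set S) →
    ((Fin m → S) → Prop) → Prop
  | 0, _, _, G => G Fin.elim0
  | _ + 1, q, I, G =>
    match q 0 with
    | .ex => ∃ s ∈ I 0, quantify (Fin.tail q) (Fin.tail I) (fun r => G (Fin.cons s r))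
    | .all => ∀ s ∈ I 0, quantify (Fin.tail q) (Fin.tail I) (fun r => G (Fin.cons s r))

/-- The quantitative counterpart of `quantify`: maximise over existentially quantified and
minimise over universally quantified initial states. -/
def quantifyValue {S : Type*} : {m : ℕ} → (Fin m → Quant) → (Fin m → Set S) →
    ((Fin m → S) → ℝ≥0∞) → ℝ≥0∞
  | 0, _, _, G => G Fin.elim0
  | _ + 1, q, I, G =>
    match q 0 with
    | .ex => ⨆ s ∈ I 0, quantifyValue (Fin.tail q) (Fin.tail I) (fun r => G (Fin.cons s r))
    | .all => ⨅ s ∈ I 0, quantifyValue (Fin.tail q) (Fin.tail I) (fun r => G (Fin.cons s r))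

variable {S Act AP Q : Type*} {n m : ℕ}

/-- The memoryless policies `σ₁ … σₙ` witness the formula on `M`: the quantified probability
constraint holds in the `m`-self-composition in which replica `i` follows the policy that it is
bound to. -/
def Formula.Witness [Fintype S] (Φ : Formula S AP n m) (M : MDP S Act (Set AP))
    (σ : Fin n → S → Act) : Prop :=
  quantify Φ.quant Φ.I fun s =>
    ENNReal.ofReal Φ.threshold <
      pathProb ((M.selfComp m).induced fun r i => σ (Φ.bind i) (r i)) s
        {π | Φ.body.Sat fun t => (M.selfComp m).L (π t)}

/-! ### The synchronised product -/

/-- States of the synchronised product. -/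
abbrev ProdState (S Q : Type*) (m : ℕ) := (Fin m → S) × Q

/-- Actions of the synchronised product; `Unit` holds the fresh automaton action. -/
abbrev ProdAct (Act : Type*) (m : ℕ) := (Fin m → Act) × Unit

/-- Memoryless policies of the synchronised product. -/
abbrev ProdPolicy (S Act Q : Type*) (m : ℕ) := ProdState S Q m → ProdAct Act m

/-- The synchronised product of `M` and `A`. -/
def syncProd [Fintype S] (M : MDP S Act (Set AP)) (A : DRA Q (Fin m → Set AP)) :
    MDP (ProdState S Q m) (ProdAct Act m) (Fin m → Set AP) where
  P x a := ((M.selfComp m).P x.1 a.1).map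
    fun s' => (s', A.δ x.2 ((M.selfComp m).L x.1))
  L x := (M.selfComp m).L x.1

/-- `C` is a bottom strongly connected component of the chain: it is nonempty, and the states
reachable from any of its states are exactly its states. -/
def IsBSCC {X : Type*} (P : X → PMF X) (C : Set X) : Prop :=
  C.Nonempty ∧ ∀ x ∈ C, ∀ y, y ∈ C ↔ Relation.ReflTransGen (fun u v => P u v ≠ 0) x y

/-- The success set in the chain induced by `τ` on the synchronised product: the union of the
bottom strongly connected components that satisfy the Rabin condition. -/
def successSet [Fintype S] (M : MDP S Act (Set AP)) (A : DRA Q (Fin m → Set AP))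
    (τ : ProdPolicy S Act Q m) : Set (ProdState S Q m) :=
  {x | ∃ C, IsBSCC ((syncProd M A).induced τ) C ∧
    (∃ p ∈ A.Acc, (∀ y ∈ C, y.2 ∉ p.1) ∧ ∃ y ∈ C, y.2 ∈ p.2) ∧ x ∈ C}

/-- The value of a policy of the synchronised product: the probability of reaching the success
set, optimised over the quantified initial states. -/
def value [Fintype S] (M : MDP S Act (Set AP)) (A : DRA Q (Fin m → Set AP))
    (Φ : Formula S AP n m) (τ : ProdPolicy S Act Q m) : ℝ≥0∞ :=
  quantifyValue Φ.quant Φ.I fun s =>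
    reachProb ((syncProd M A).induced τ) (s, A.q₀) (successSet M A τ)

/-! ### Consistency of policies -/

def ViolatesLocalObservability (τ : ProdPolicy S Act Q m) : Prop :=
  ∃ (i : Fin m) (x y : ProdState S Q m), x.1 i = y.1 i ∧ (τ x).1 i ≠ (τ y).1 i

def ViolatesPolicyBindings (bind : Fin m → Fin n) (τ : ProdPolicy S Act Q m) : Prop :=
  ∃ i j : Fin m, i ≠ j ∧ bind i = bind j ∧
    ∃ x y : ProdState S Q m, x.1 i = y.1 j ∧ (τ x).1 i ≠ (τ y).1 j

def Inconsistent (bind : Fin m → Fin n) (τ : ProdPolicy S Act Q m) : Prop :=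
  ViolatesLocalObservability τ ∨ ViolatesPolicyBindings bind τ

/-- The policy of the product in which every agent `i` follows the policy it is bound to. -/
def lift (bind : Fin m → Fin n) (σ : Fin n → S → Act) : ProdPolicy S Act Q m :=
  fun x => (fun i => σ (bind i) (x.1 i), ())

/-- `σ` is a factorisation of `τ`. -/
def Factorises (bind : Fin m → Fin n) (τ : ProdPolicy S Act Q m) (σ : Fin n → S → Act) : Prop :=
  ∀ (j : Fin m) (x : ProdState S Q m), σ (bind j) (x.1 j) = (τ x).1 j

/-- `σ` resolves the inconsistencies of `τ`: each `σ v s` is one of the actions that `τ` selects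
for some agent bound to the policy variable `v` in a state where this agent is in `s` (no
constraint if no agent is bound to `v`). -/
def Resolves (bind : Fin m → Fin n) (τ : ProdPolicy S Act Q m) (σ : Fin n → S → Act) : Prop :=
  ∀ (v : Fin n) (s : S), (∃ j, bind j = v) →
    ∃ (j : Fin m) (x : ProdState S Q m), bind j = v ∧ x.1 j = s ∧ σ v s = (τ x).1 j

/-! ### Submodels and abstraction refinement -/

/-- A submodel of the synchronised product: `D x k` is the set of actions that agent `k` may
take in state `x`. -/
abbrev Submodel (S Act Q : Type*) (m : ℕ) := ProdState S Q m → Fin m → Set Act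

/-- The unrestricted synchronised product. -/
def fullModel : Submodel S Act Q m := fun _ _ => Set.univ

/-- `τ` is a policy of the submodel `D`. -/
def Submodel.IsPolicy (D : Submodel S Act Q m) (τ : ProdPolicy S Act Q m) : Prop :=
  ∀ x k, (τ x).1 k ∈ D x k

/-- `τ` is an optimal policy of the submodel `D`. -/
def Submodel.IsOptimal [Fintype S] (M : MDP S Act (Set AP)) (A : DRA Q (Fin m → Set AP))
    (Φ : Formula S AP n m) (D : Submodel S Act Q m) (τ : ProdPolicy S Act Q m) : Prop :=
  D.IsPolicy τ ∧ ∀ τ', D.IsPolicy τ' → value M A Φ τ' ≤ value M A Φ τ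

open Classical in
/-- Replace the action set of every agent `k` bound to the policy variable `v`, in every state
in which `k` is in the local state `s`, by its image under `f`. -/
def Submodel.modify (bind : Fin m → Fin n) (v : Fin n) (s : S) (f : Set Act → Set Act)
    (D : Submodel S Act Q m) : Submodel S Act Q m :=
  fun x k => if bind k = v ∧ x.1 k = s then f (D x k) else D x k

/-- Configurations of the algorithm: the submodels still to be analysed, or a result. -/
inductive Config (S Act Q : Type*) (n m : ℕ) where
  | pending (W : Multiset (Submodel S Act Q m)) : Config S Act Q n m
  | found (σ : Fin n → S → Act) : Config S Act Q n m
  | noSolution : Config S Act Q n m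

/-- One step of abstraction refinement. All choices (next submodel, optimal policy, resolution
of inconsistencies, conflict to split on) are arbitrary. -/
inductive Step [Fintype S] (M : MDP S Act (Set AP)) (A : DRA Q (Fin m → Set AP))
    (Φ : Formula S AP n m) : Config S Act Q n m → Config S Act Q n m → Prop
  /-- All submodels have been discarded. -/
  | finish : Step M A Φ (.pending 0) .noSolution
  /-- A submodel without policies (some action set is empty) is discarded. -/
  | discardEmpty {W : Multiset (Submodel S Act Q m)} {D : Submodel S Act Q m}
      (hD : ∀ τ, ¬ D.IsPolicy τ) :
      Step M A Φ (.pending (D ::ₘ W)) (.pending W)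
  /-- The optimum of the submodel does not exceed the threshold: the submodel is discarded. -/
  | discard {W : Multiset (Submodel S Act Q m)} {D : Submodel S Act Q m}
      {τ : ProdPolicy S Act Q m} (hτ : D.IsOptimal M A Φ τ)
      (hv : value M A Φ τ ≤ ENNReal.ofReal Φ.threshold) :
      Step M A Φ (.pending (D ::ₘ W)) (.pending W)
  /-- The optimal policy is good enough and consistent: its factorisation is returned. -/
  | factorise {W : Multiset (Submodel S Act Q m)} {D : Submodel S Act Q m}
      {τ : ProdPolicy S Act Q m} (hτ : D.IsOptimal M A Φ τ)
      (hv : ENNReal.ofReal Φ.threshold < value M A Φ τ)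
      (hc : ¬ Inconsistent Φ.bind τ)
      {σ : Fin n → S → Act} (hσ : Factorises Φ.bind τ σ) :
      Step M A Φ (.pending (D ::ₘ W)) (.found σ)
  /-- The optimal policy is good enough but inconsistent; resolving its inconsistencies gives
  a tuple that is good enough: this tuple is returned. -/
  | resolve {W : Multiset (Submodel S Act Q m)} {D : Submodel S Act Q m}
      {τ : ProdPolicy S Act Q m} (hτ : D.IsOptimal M A Φ τ)
      (hv : ENNReal.ofReal Φ.threshold < value M A Φ τ)
      (hc : Inconsistent Φ.bind τ)
      {σ : Fin n → S → Act} (hσ : Resolves Φ.bind τ σ)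
      (hs : ENNReal.ofReal Φ.threshold < value M A Φ (lift Φ.bind σ)) :
      Step M A Φ (.pending (D ::ₘ W)) (.found σ)
  /-- The optimal policy is good enough but inconsistent, and resolving its inconsistencies
  fails: the submodel is split into three on a pair of conflicting actions. -/
  | split {W : Multiset (Submodel S Act Q m)} {D : Submodel S Act Q m}
      {τ : ProdPolicy S Act Q m} (hτ : D.IsOptimal M A Φ τ)
      (hv : ENNReal.ofReal Φ.threshold < value M A Φ τ)
      (hc : Inconsistent Φ.bind τ)
      {σ : Fin n → S → Act} (hσ : Resolves Φ.bind τ σ)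
      (hs : value M A Φ (lift Φ.bind σ) ≤ ENNReal.ofReal Φ.threshold)
      {i j : Fin m} {x y : ProdState S Q m}
      (hb : Φ.bind i = Φ.bind j) (hxy : x.1 i = y.1 j)
      {a b : Act} (ha : a = (τ x).1 i) (hb' : b = (τ y).1 j) (hab : a ≠ b) :
      Step M A Φ (.pending (D ::ₘ W))
        (.pending
          (D.modify Φ.bind (Φ.bind i) (x.1 i) (fun _ => {a}) ::ₘ
           D.modify Φ.bind (Φ.bind i) (x.1 i) (fun _ => {b}) ::ₘ
           D.modify Φ.bind (Φ.bind i) (x.1 i) (fun B => B \ {a, b}) ::ₘ W))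

/-- The algorithm starts with the whole synchronised product. -/
def initial : Config S Act Q n m := .pending {fullModel}

/-- `c` occurs in some run of the algorithm. -/
def Reachable [Fintype S] (M : MDP S Act (Set AP)) (A : DRA Q (Fin m → Set AP))
    (Φ : Formula S AP n m) (c : Config S Act Q n m) : Prop :=
  Relation.ReflTransGen (Step M A Φ) initial c

end

end PHLTL

open PHLTL

/-! Two independent facts carry the theorem. The first is semantic: a tuple witnesses the
specification iff the product policy it defines has value above the threshold
(`lt_value_lift_iff_witness`). A replica path and its automaton run together form a path of the
product chain (`map_liftPath`). Almost surely the states visited infinitely often form a bottom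
component (`ae_isBSCC_frequently`), so Rabin acceptance is reaching an accepting one
(`ae_rabin_iff_reach`). Finiteness of `S` carries the strict bound through the quantifiers.

The second is combinatorial. Every tuple of value above the threshold stays a policy of some pending
submodel (`Config.Invariant.step`): discarding removes only policies of low value, and the three
parts of a split cover all choices of `σ v s`. Action sets depend only on the policy variable and
local state, so both conflicting actions are allowed at the same place and each part is strictly
smaller. This gives termination (`Step.weight_lt`). A pending configuration always has a successor
(`Step.exists_of_pending`). -/

namespace PHLTL

open MeasureTheory ProbabilityTheory Filter Preorder

/-! ### Markov property and recurrence of finite chains -/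

section MarkovChain

variable {X : Type*} [MeasurableSpace X] [DiscreteMeasurableSpace X]

instance (P : X → PMF X) (x : X) : IsProbabilityMeasure (pathMeasure P x) := by
  unfold pathMeasure; infer_instance

theorem pathMeasure_eq_traj (P : X → PMF X) (x : X) :
    pathMeasure P x = Kernel.traj (X := fun _ => X) (stepKernel P) 0 (fun _ => x) := by
  have h := Measure.map_dirac
    (f := (MeasurableEquiv.piUnique fun _ : Finset.Iic 0 => X).symm) x
  refine (congrArg (fun μ => μ.bind (Kernel.traj (X := fun _ => X) (stepKernel P) 0)) h).trans ?_
  exact Measure.dirac_bind (Kernel.measurable _) _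

theorem stepKernel_apply (P : X → PMF X) (t : ℕ) (π : ℕ → X) :
    stepKernel P t (frestrictLe (π := fun _ => X) t π) = (P (π t)).toMeasure := rfl

variable [Finite X]

/-- The Markov property, for an event `E` that is determined by the path up to time `t`. -/
theorem pathMeasure_inter_succ (P : X → PMF X) (x : X) {t : ℕ} {E : Set (ℕ → X)}
    (hE : ∀ π π' : ℕ → X, (∀ i ≤ t, π i = π' i) → π ∈ E → π' ∈ E) {u : X}
    (hu : ∀ᵐ π ∂pathMeasure P x, π ∈ E → π t = u) (V : Set X) :
    pathMeasure P x (E ∩ {π | π (t + 1) ∈ V}) =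
      pathMeasure P x E * (P u).toMeasure V := by
  -- `hE` makes `E` the preimage of a set of finite histories; those form a discrete space, so `E`
  -- is measurable.
  have hB : frestrictLe (π := fun _ => X) t ⁻¹' (frestrictLe (π := fun _ => X) t '' E) = E := by
    refine Set.Subset.antisymm ?_ (Set.subset_preimage_image _ _)
    rintro π' ⟨π, hπ, h⟩
    exact hE π π' (fun i hi => congrFun h ⟨i, Finset.mem_Iic.2 hi⟩) hπ
  set B := frestrictLe (π := fun _ => X) t '' E
  have hBm : MeasurableSet B := MeasurableSet.of_discrete
  have hVm : MeasurableSet V := MeasurableSet.of_discrete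
  have hEm : MeasurableSet E := hB ▸ measurable_frestrictLe t hBm
  have key := congrArg (fun μ => μ (B ×ˢ V))
    (Kernel.map_frestrictLe_trajMeasure_compProd_eq_map_trajMeasure (X := fun _ => X)
      (κ := stepKernel P) (μ₀ := Measure.dirac x) (a := t))
  beta_reduce at key
  rw [Measure.compProd_apply_prod hBm hVm, Measure.map_apply (by fun_prop) (hBm.prod hVm),
    setLIntegral_map hBm (Kernel.measurable_coe _ hVm) (by fun_prop), hB] at key
  have h1 : (fun π : ℕ → X => (frestrictLe (π := fun _ => X) t π, π (t + 1))) ⁻¹' (B ×ˢ V) =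
      E ∩ {π | π (t + 1) ∈ V} := by
    rw [← hB]; rfl
  rw [h1] at key
  refine key.symm.trans ?_
  have h2 : ∀ᵐ π ∂(pathMeasure P x).restrict E,
      stepKernel P t (frestrictLe (π := fun _ => X) t π) V = (P u).toMeasure V := by
    rw [ae_restrict_iff' hEm]
    filter_upwards [hu] with π hπ hπE
    rw [stepKernel_apply, hπ hπE]
  refine (lintegral_congr_ae h2).trans ?_
  rw [lintegral_const, Measure.restrict_apply_univ, mul_comm]

theorem ae_pathMeasure_zero (P : X → PMF X) (x : X) : ∀ᵐ π ∂pathMeasure P x, π 0 = x := by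
  have h := Kernel.traj_map_frestrictLe_apply (X := fun _ => X) (κ := stepKernel P) 0 0
    (fun _ => x)
  rw [← pathMeasure_eq_traj, Kernel.partialTraj_self, Kernel.id_apply] at h
  have h' : ∀ᵐ p ∂((pathMeasure P x).map (frestrictLe (π := fun _ => X) 0)),
      p ⟨0, Finset.mem_Iic.2 le_rfl⟩ = x := by
    rw [h, ae_dirac_iff MeasurableSet.of_discrete]
  exact ae_of_ae_map (by fun_prop) h'

/-- Almost surely, the path only makes transitions of positive probability. -/
theorem ae_pathMeasure_step (P : X → PMF X) (x : X) :
    ∀ᵐ π ∂pathMeasure P x, ∀ t, P (π t) (π (t + 1)) ≠ 0 := by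
  rw [ae_all_iff]
  intro t
  have h : ∀ u v : X, ∀ᵐ π ∂pathMeasure P x, P u v = 0 → ¬ (π t = u ∧ π (t + 1) = v) := by
    intro u v
    by_cases hp : P u v = 0
    · have := pathMeasure_inter_succ P x (t := t) (E := {π | π t = u})
        (fun π π' h1 h2 => (h1 t le_rfl).symm.trans h2) (u := u) (ae_of_all _ fun _ h => h) {v}
      rw [PMF.toMeasure_apply_singleton _ _ MeasurableSet.of_discrete, hp, mul_zero] at this
      rw [ae_iff]
      convert! this using 2
      ext π; simp [hp]
    · exact ae_of_all _ fun _ h => absurd h hp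
  have h' := ae_all_iff.2 fun u => ae_all_iff.2 (h u)
  filter_upwards [h'] with π hπ h0
  exact hπ _ _ h0 ⟨rfl, rfl⟩

/-- Almost surely, the set of states visited infinitely often is closed under transitions. -/
theorem ae_pathMeasure_frequently (P : X → PMF X) (x : X) :
    ∀ᵐ π ∂pathMeasure P x, ∀ u v, P u v ≠ 0 →
      (∃ᶠ t in atTop, π t = u) → ∃ᶠ t in atTop, π t = v := by
  rw [ae_all_iff]; intro u
  rw [ae_all_iff]; intro v
  by_cases hp : P u v = 0
  · exact ae_of_all _ fun _ h => absurd hp h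
  set s : ℕ → Set (ℕ → X) := fun t => {π | π t = v} with hs
  have hsm : ∀ t, MeasurableSet[Filtration.piLE (X := fun _ => X) t] (s t) := by
    intro t
    rw [Filtration.piLE_eq_comap_frestrictLe]
    exact ⟨{p | p ⟨t, Finset.mem_Iic.2 le_rfl⟩ = v}, MeasurableSet.of_discrete, rfl⟩
  have hsm' : ∀ t, MeasurableSet (s t) := fun t => Filtration.piLE.le t _ (hsm t)
  have hcond : ∀ t, (pathMeasure P x)[(s (t + 1)).indicator (1 : (ℕ → X) → ℝ) |
      Filtration.piLE (X := fun _ => X) t] =ᵐ[pathMeasure P x] fun π => (P (π t) v).toReal := by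
    intro t
    rw [pathMeasure_eq_traj]
    refine (Kernel.condExp_traj (Nat.zero_le t)
      ((integrable_const (1 : ℝ)).indicator (hsm' (t + 1)))).trans (ae_of_all _ fun π => ?_)
    have h1 : Kernel.traj (X := fun _ => X) (stepKernel P) t
        (frestrictLe (π := fun _ => X) t π) (s (t + 1)) = P (π t) v := by
      rw [← PMF.toMeasure_apply_singleton _ _ (MeasurableSet.of_discrete (s := {v})),
        ← stepKernel_apply, ← Kernel.map_traj_succ_self (X := fun _ => X) (κ := stepKernel P),
        Kernel.map_apply' _ (measurable_pi_apply (t + 1)) _ MeasurableSet.of_discrete]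
      rfl
    have h2 := integral_indicator_one (μ := Kernel.traj (X := fun _ => X) (stepKernel P) t
      (frestrictLe (π := fun _ => X) t π)) (hsm' (t + 1))
    exact h2.trans (congrArg ENNReal.toReal h1)
  -- Lévy's conditional Borel–Cantelli lemma: `v` is visited infinitely often iff the conditional
  -- probabilities of moving to `v` have divergent sum.
  filter_upwards [ae_mem_limsup_atTop_iff (ℱ := Filtration.piLE (X := fun _ => X))
    (pathMeasure P x) hsm, ae_all_iff.2 hcond] with π hπ hc _ hu
  have hmem : π ∈ limsup s atTop := by
    rw [hπ]
    simp_rw [hc]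
    have h1 := (not_summable_iff_tendsto_nat_atTop_of_nonneg
      (f := fun t => (P (π t) v).toReal) fun t => ENNReal.toReal_nonneg).1 ?_
    · exact h1
    -- Summable terms tend to `0`, but each visit to `u` contributes the same positive `P u v`.
    intro hsum
    have hlim := hsum.tendsto_atTop_zero
    have hpos : 0 < (P u v).toReal := ENNReal.toReal_pos hp (PMF.apply_ne_top _ _)
    obtain ⟨t, ht, htu⟩ := ((hlim.eventually_lt_const hpos).and_frequently hu).exists
    rw [htu] at ht
    exact lt_irrefl _ ht
  rw [mem_limsup_iff_frequently_mem] at hmem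
  exact hmem

end MarkovChain

/-! ### Uniqueness of the path law -/

section Characterisation

variable {X : Type*} [MeasurableSpace X] [DiscreteMeasurableSpace X] [Finite X]

/-- Every finite set of times lies in an initial segment, so cylinders fix all finite-dimensional
marginals; projective limits are unique. -/
theorem measure_ext_of_cylinders {μ ν : Measure (ℕ → X)} [IsFiniteMeasure μ] [Nonempty X]
    (h : ∀ (t : ℕ) (w : ℕ → X), μ {π | ∀ i ≤ t, π i = w i} = ν {π | ∀ i ≤ t, π i = w i}) :
    μ = ν := by
  have h1 : ∀ t, μ.map (frestrictLe (π := fun _ => X) t) =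
      ν.map (frestrictLe (π := fun _ => X) t) := by
    intro t
    refine Measure.ext_of_singleton fun p => ?_
    rw [Measure.map_apply (by fun_prop) MeasurableSet.of_discrete,
      Measure.map_apply (by fun_prop) MeasurableSet.of_discrete]
    let w : ℕ → X := fun i => if hi : i ≤ t then p ⟨i, Finset.mem_Iic.2 hi⟩
      else Classical.arbitrary X
    have hw : frestrictLe (π := fun _ => X) t ⁻¹' {p} = {π | ∀ i ≤ t, π i = w i} := by
      ext π
      simp only [Set.mem_preimage, Set.mem_singleton_iff, Set.mem_ofPred_eq, funext_iff,
        Subtype.forall, Finset.mem_Iic]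
      refine forall_congr' fun i => forall_congr' fun hi => ?_
      simp [w, hi]
    rw [hw, h]
  have h2 : ∀ I : Finset ℕ, ν.map (I.restrict (π := fun _ => X)) = μ.map I.restrict := by
    intro I
    have hI : I ⊆ Finset.Iic (I.sup id) := fun i hi =>
      Finset.mem_Iic.2 (Finset.le_sup (f := id) hi)
    have h3 : I.restrict (π := fun _ => X) =
      Finset.restrict₂ (π := fun _ => X) hI ∘ frestrictLe (π := fun _ => X) (I.sup id) := rfl
    rw [h3, ← Measure.map_map (by fun_prop) (by fun_prop),
      ← Measure.map_map (by fun_prop) (by fun_prop), h1]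
  have : ∀ I : Finset ℕ, IsFiniteMeasure (μ.map (I.restrict (π := fun _ => X))) :=
    fun I => inferInstance
  exact IsProjectiveLimit.unique (P := fun I => μ.map I.restrict) (fun I => rfl) h2

/-- Induction on the length of the cylinder; this is the criterion by which a pushforward is
recognised as a Markov chain. -/
theorem eq_pathMeasure {P : X → PMF X} {x : X} {ν : Measure (ℕ → X)} [IsProbabilityMeasure ν]
    (h0 : ∀ᵐ π ∂ν, π 0 = x)
    (hs : ∀ (t : ℕ) (w : ℕ → X), ν {π | ∀ i ≤ t + 1, π i = w i} =
      ν {π | ∀ i ≤ t, π i = w i} * P (w t) (w (t + 1))) :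
    ν = pathMeasure P x := by
  have : Nonempty X := ⟨x⟩
  refine measure_ext_of_cylinders fun t w => ?_
  induction t with
  | zero =>
    have key : ∀ κ : Measure (ℕ → X), [IsProbabilityMeasure κ] → (∀ᵐ π ∂κ, π 0 = x) →
        κ {π | ∀ i ≤ 0, π i = w i} = κ {_π | w 0 = x} := by
      intro κ _ hκ
      refine measure_congr ?_
      filter_upwards [hκ] with π hπ
      refine propext ?_
      change (∀ i ≤ 0, π i = w i) ↔ w 0 = x
      simp [hπ, eq_comm]
    rw [key ν h0, key _ (ae_pathMeasure_zero P x)]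
    by_cases hw : w 0 = x <;> simp [hw]
  | succ t ih =>
    have h := pathMeasure_inter_succ P x (t := t) (E := {π | ∀ i ≤ t, π i = w i})
      (fun π π' h1 h2 i hi => (h1 i hi).symm.trans (h2 i hi)) (u := w t)
      (ae_of_all _ fun _ h => h t le_rfl) {w (t + 1)}
    rw [PMF.toMeasure_apply_singleton _ _ MeasurableSet.of_discrete] at h
    rw [hs, ih, ← h]
    congr 1
    ext π
    simp only [Set.mem_inter_iff, Set.mem_ofPred_eq, Set.mem_singleton_iff, Nat.le_succ_iff]
    exact ⟨fun h i hi => hi.elim (h.1 i) fun hi => hi ▸ h.2,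
      fun h => ⟨fun i hi => h i (.inl hi), h _ (.inr rfl)⟩⟩

end Characterisation

/-! ### Chains extended by a deterministic observer -/

/-- The path of an observer that starts in `y` and deterministically updates its state with
every new state of the observed path. -/
def liftPath {X Y : Type*} (next : Y → X → Y) (y : Y) (π : ℕ → X) : ℕ → Y
  | 0 => y
  | t + 1 => next (liftPath next y π t) (π (t + 1))

theorem liftPath_congr {X Y : Type*} (next : Y → X → Y) (y : Y) {π π' : ℕ → X} {t : ℕ}
    (h : ∀ i ≤ t, π i = π' i) : liftPath next y π t = liftPath next y π' t := by
  induction t with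
  | zero => rfl
  | succ t ih =>
    simp only [liftPath]
    rw [ih fun i hi => h i (by omega), h _ le_rfl]

section LiftPath

variable {X Y : Type*} [MeasurableSpace X] [DiscreteMeasurableSpace X] [Finite X]
  [MeasurableSpace Y] [DiscreteMeasurableSpace Y] [Finite Y]

theorem measurable_liftPath (next : Y → X → Y) (y : Y) : Measurable (liftPath next y) := by
  refine measurable_pi_lambda _ fun t => ?_
  induction t with
  | zero => exact measurable_const
  | succ t ih =>
    exact (Measurable.of_discrete (f := fun p : Y × X => next p.1 p.2)).comp
      (ih.prodMk (measurable_pi_apply (t + 1)))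

/-- The observed chain together with the state of the observer is a Markov chain. -/
theorem map_liftPath (P : X → PMF X) (st : Y → X) (next : Y → X → Y)
    (hst : ∀ y x, st (next y x) = x) (y : Y) :
    (pathMeasure P (st y)).map (liftPath next y) =
      pathMeasure (fun y => (P (st y)).map (next y)) y := by
  have hm := measurable_liftPath next y
  have := Measure.isProbabilityMeasure_map (μ := pathMeasure P (st y)) hm.aemeasurable
  have hms : ∀ (t : ℕ) (w : ℕ → Y), MeasurableSet {π : ℕ → Y | ∀ i ≤ t, π i = w i} := by
    intro t w
    simp only [Set.ofPred_forall]
    exact MeasurableSet.iInter fun i => MeasurableSet.iInter fun _ =>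
      measurableSet_eq_fun (measurable_pi_apply i) measurable_const
  refine eq_pathMeasure ?_ fun t w => ?_
  · exact (ae_map_iff hm.aemeasurable
      (measurable_pi_apply 0 (MeasurableSet.of_discrete (s := {y})))).2 (ae_of_all _ fun _ => rfl)
  · have h := pathMeasure_inter_succ P (st y) (t := t)
      (E := {π | ∀ i ≤ t, liftPath next y π i = w i}) (u := st (w t))
      (fun π π' h1 h2 i hi =>
        (liftPath_congr next y fun j hj => (h1 j (hj.trans hi)).symm).trans (h2 i hi)) (by
        -- The observer state determines the chain state: by `hst` at later times, but only almost
        -- surely at time `0`, where `liftPath` ignores the path.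
        filter_upwards [ae_pathMeasure_zero P (st y)] with π h0 hπ
        rw [← hπ t le_rfl]
        cases t with
        | zero => exact h0
        | succ t => exact (hst _ _).symm) {x' | next (w t) x' = w (t + 1)}
    rw [Measure.map_apply hm (hms _ _), Measure.map_apply hm (hms _ _),
      ← PMF.toMeasure_apply_singleton _ _ MeasurableSet.of_discrete,
      PMF.toMeasure_map_apply _ _ _ Measurable.of_discrete MeasurableSet.of_discrete]
    refine Eq.trans ?_ h
    congr 1
    ext π
    simp only [Set.mem_inter_iff, Set.mem_ofPred_eq, Set.mem_preimage, Nat.le_succ_iff]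
    constructor
    · intro h
      refine ⟨fun i hi => h i (.inl hi), ?_⟩
      rw [← h t (.inl le_rfl)]
      exact h (t + 1) (.inr rfl)
    · rintro ⟨h, h'⟩ i (hi | rfl)
      · exact h i hi
      · rw [← h', ← h t le_rfl]
        rfl

end LiftPath

/-! ### Limit behaviour and bottom components -/

section Limit

theorem IsBSCC.mem_of_le {X : Type*} {P : X → PMF X} {C : Set X} (hC : IsBSCC P C) {π : ℕ → X}
    (hπ : ∀ t, P (π t) (π (t + 1)) ≠ 0) {s t : ℕ} (hs : π s ∈ C) (hst : s ≤ t) : π t ∈ C := by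
  induction t, hst using Nat.le_induction with
  | base => exact hs
  | succ t _ ih => exact (hC.2 _ ih _).2 (.single (hπ t))

theorem IsBSCC.eq_of_mem {X : Type*} {P : X → PMF X} {C C' : Set X} (hC : IsBSCC P C)
    (hC' : IsBSCC P C') {x : X} (hx : x ∈ C) (hx' : x ∈ C') : C = C' :=
  Set.ext fun y => (hC.2 x hx y).trans (hC'.2 x hx' y).symm

theorem reflTransGen_of_path {X : Type*} {r : X → X → Prop} {π : ℕ → X}
    (hπ : ∀ t, r (π t) (π (t + 1))) {s t : ℕ} (hst : s ≤ t) :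
    Relation.ReflTransGen r (π s) (π t) := by
  induction t, hst using Nat.le_induction with
  | base => exact .refl
  | succ t _ ih => exact ih.tail (hπ t)

/-- Pigeonhole: if each of finitely many states is eventually avoided, all are avoided from a common
time on. -/
theorem exists_frequently_eq {X : Type*} [Finite X] {π : ℕ → X} {p : X → Prop}
    (h : ∃ᶠ t in atTop, p (π t)) : ∃ x, p x ∧ ∃ᶠ t in atTop, π t = x := by
  by_contra! hc
  refine h ?_
  have : ∀ᶠ t in atTop, ∀ x, p x → π t ≠ x :=
    eventually_all.2 fun x => eventually_imp_distrib_left.2 fun hx => hc x hx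
  exact this.mono fun t ht hp => ht _ hp rfl

/-- Almost surely, the states visited infinitely often form a bottom strongly connected
component. -/
theorem ae_isBSCC_frequently {X : Type*} [MeasurableSpace X] [DiscreteMeasurableSpace X]
    [Finite X] (P : X → PMF X) (x : X) :
    ∀ᵐ π ∂pathMeasure P x, IsBSCC P {u | ∃ᶠ t in atTop, π t = u} := by
  filter_upwards [ae_pathMeasure_step P x, ae_pathMeasure_frequently P x] with π hs hf
  refine ⟨?_, fun u hu v => ⟨fun hv => ?_, fun h => ?_⟩⟩
  · obtain ⟨u, -, hu⟩ := exists_frequently_eq (π := π) (p := fun _ => True)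
      (Eventually.of_forall fun _ => trivial).frequently
    exact ⟨u, hu⟩
  -- A visit to `u` is followed by a visit to `v`, so the path itself witnesses reachability.
  · obtain ⟨s, -, rfl⟩ := frequently_atTop.1 hu 0
    obtain ⟨t, hst, rfl⟩ := frequently_atTop.1 hv s
    exact reflTransGen_of_path hs hst
  · induction h with
    | refl => exact hu
    | tail _ hbc ih => exact hf _ _ hbc ih

end Limit

/-! ### Satisfaction in the self-composition versus reachability in the product -/

section Product

variable {S Act AP Q : Type*} {n m : ℕ} [Fintype S]

/-- Both sides read the label of the state being left, so the indices agree; `h0` is needed because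
`liftPath` starts from `s` whatever `π 0` is. -/
theorem snd_liftPath_eq_run (M : MDP S Act (Set AP)) (A : DRA Q (Fin m → Set AP))
    {s : Fin m → S} {π : ℕ → Fin m → S} (h0 : π 0 = s) (t : ℕ) :
    liftPath (fun (y : ProdState S Q m) s' => (s', A.δ y.2 ((M.selfComp m).L y.1))) (s, A.q₀) π t =
      (π t, A.run (fun t => (M.selfComp m).L (π t)) t) := by
  induction t with
  | zero => simp [liftPath, DRA.run, h0]
  | succ t ih => simp only [liftPath, ih, DRA.run]

/-- Almost surely, a path of the product satisfies the Rabin condition iff it reaches the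
success set. -/
theorem ae_rabin_iff_reach [Finite Q] [MeasurableSpace (ProdState S Q m)]
    [DiscreteMeasurableSpace (ProdState S Q m)] (M : MDP S Act (Set AP))
    (A : DRA Q (Fin m → Set AP)) (τ : ProdPolicy S Act Q m) (x : ProdState S Q m) :
    ∀ᵐ π ∂pathMeasure ((syncProd M A).induced τ) x,
      (∃ p ∈ A.Acc, {t | (π t).2 ∈ p.1}.Finite ∧ {t | (π t).2 ∈ p.2}.Infinite) ↔
        ∃ t, π t ∈ successSet M A τ := by
  filter_upwards [ae_pathMeasure_step ((syncProd M A).induced τ) x,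
    ae_isBSCC_frequently ((syncProd M A).induced τ) x] with π hs hC
  constructor
  · rintro ⟨p, hp, hL, hK⟩
    obtain ⟨y, hy, hyf⟩ := exists_frequently_eq (π := π) (p := fun y => y.2 ∈ p.2)
      (Nat.frequently_atTop_iff_infinite.2 hK)
    obtain ⟨t, ht⟩ := hyf.exists
    refine ⟨t, _, hC, ⟨p, hp, fun z hz hzL => ?_, y, hyf, hy⟩, ?_⟩
    · exact Nat.frequently_atTop_iff_infinite.1
        (Frequently.mono (p := fun t => π t = z) hz fun t (h : π t = z) => by rwa [h]) hL
    · rw [ht]; exact hyf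
  · rintro ⟨t, C, hCb, ⟨p, hp, hL, y, hyC, hy⟩, ht⟩
    have hev : ∀ t' ≥ t, π t' ∈ C := fun t' h => hCb.mem_of_le hs ht h
    obtain ⟨u, hu⟩ := hC.1
    obtain ⟨t', htt', rfl⟩ := frequently_atTop.1 hu t
    -- The path stays in `C` after entering it, so `C` meets the bottom component of recurrent
    -- states and equals it.
    have hCC := hCb.eq_of_mem hC (hev t' htt') hu
    refine ⟨p, hp, (Set.finite_lt_nat t).subset fun r hr => ?_, ?_⟩
    · by_contra h
      exact hL _ (hev r (not_lt.1 h)) hr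
    · rw [hCC] at hyC
      exact Nat.frequently_atTop_iff_infinite.1
        (Frequently.mono (p := fun t => π t = y) hyC fun t (h : π t = y) => by rwa [h])

/-- Under a lifted policy the automaton component is a deterministic observer of the
self-composition, so the product path law is a pushforward and the two events agree almost surely.
-/
theorem pathProb_sat_eq_reachProb [Finite Q] (M : MDP S Act (Set AP)) (Φ : Formula S AP n m)
    (A : DRA Q (Fin m → Set AP)) (hA : ∀ w, A.Accepts w ↔ Φ.body.Sat w) (σ : Fin n → S → Act)
    (s : Fin m → S) :
    pathProb ((M.selfComp m).induced fun r i => σ (Φ.bind i) (r i)) s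
        {π | Φ.body.Sat fun t => (M.selfComp m).L (π t)} =
      reachProb ((syncProd M A).induced (lift Φ.bind σ)) (s, A.q₀)
        (successSet M A (lift Φ.bind σ)) := by
  unfold reachProb pathProb
  let _ : MeasurableSpace (Fin m → S) := ⊤
  let _ : MeasurableSpace (ProdState S Q m) := ⊤
  set P := (M.selfComp m).induced fun r i => σ (Φ.bind i) (r i) with hP
  set next : ProdState S Q m → (Fin m → S) → ProdState S Q m :=
    fun y s' => (s', A.δ y.2 ((M.selfComp m).L y.1)) with hnext
  have hmap : (pathMeasure P s).map (liftPath next (s, A.q₀)) =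
      pathMeasure ((syncProd M A).induced (lift Φ.bind σ)) (s, A.q₀) :=
    map_liftPath P Prod.fst next (fun _ _ => rfl) (s, A.q₀)
  have hm := measurable_liftPath next (s, A.q₀)
  set F : Set (ℕ → ProdState S Q m) := {π | ∃ t, π t ∈ successSet M A (lift Φ.bind σ)} with hF
  have hFm : MeasurableSet F := by
    rw [hF, Set.ofPred_exists]
    exact MeasurableSet.iUnion fun t => measurable_pi_apply t MeasurableSet.of_discrete
  have hae := ae_rabin_iff_reach M A (lift Φ.bind σ) (s, A.q₀)
  rw [← hmap] at hae
  change _ = pathMeasure ((syncProd M A).induced (lift Φ.bind σ)) (s, A.q₀) F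
  rw [← hmap, Measure.map_apply hm hFm]
  refine measure_congr ?_
  filter_upwards [ae_of_ae_map hm.aemeasurable hae, ae_pathMeasure_zero P s] with π hπ h0
  refine propext ?_
  change Φ.body.Sat (fun t => (M.selfComp m).L (π t)) ↔
    ∃ t, liftPath next (s, A.q₀) π t ∈ successSet M A (lift Φ.bind σ)
  rw [← hA, ← hπ]
  simp only [hnext, snd_liftPath_eq_run M A h0]
  rfl

/-- A strict lower bound survives an infimum because it is finite; `r < ⊤` handles the empty one. -/
theorem lt_quantifyValue_iff {S : Type*} [Finite S] {r : ENNReal} (hr : r < ⊤) :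
    ∀ {m : ℕ} (q : Fin m → Quant) (I : Fin m → Set S) (G : (Fin m → S) → ENNReal),
      r < quantifyValue q I G ↔ quantify q I fun s => r < G s
  | 0, _, _, _ => Iff.rfl
  | m + 1, q, I, G => by
    unfold quantifyValue quantify
    cases q 0 with
    | ex =>
      simp only [lt_iSup_iff, exists_prop]
      exact exists_congr fun s => and_congr_right fun _ => lt_quantifyValue_iff hr _ _ _
    | all =>
      have h : r < (⨅ s ∈ I 0, quantifyValue (Fin.tail q) (Fin.tail I) fun t => G (Fin.cons s t)) ↔
          ∀ s ∈ I 0, r < quantifyValue (Fin.tail q) (Fin.tail I) fun t => G (Fin.cons s t) := by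
        simpa only [Finset.inf_eq_iInf, Set.Finite.mem_toFinset] using
          Finset.lt_inf_iff (s := (Set.toFinite (I 0)).toFinset)
            (f := fun s => quantifyValue (Fin.tail q) (Fin.tail I) fun t => G (Fin.cons s t)) hr
      rw [h]
      exact forall₂_congr fun s _ => lt_quantifyValue_iff hr _ _ _

theorem lt_value_lift_iff_witness [Finite Q] (M : MDP S Act (Set AP)) (Φ : Formula S AP n m)
    (A : DRA Q (Fin m → Set AP)) (hA : ∀ w, A.Accepts w ↔ Φ.body.Sat w)
    (σ : Fin n → S → Act) :
    ENNReal.ofReal Φ.threshold < value M A Φ (lift Φ.bind σ) ↔ Φ.Witness M σ := by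
  unfold value Formula.Witness
  rw [lt_quantifyValue_iff ENNReal.ofReal_lt_top]
  simp only [pathProb_sat_eq_reachProb M Φ A hA σ]

end Product

/-! ### Consistency, factorisation and resolution -/

section Policies

variable {S Act Q : Type*} {n m : ℕ} {bind : Fin m → Fin n}

theorem inconsistent_iff {τ : ProdPolicy S Act Q m} :
    Inconsistent bind τ ↔ ∃ (i j : Fin m) (x y : ProdState S Q m),
      bind i = bind j ∧ x.1 i = y.1 j ∧ (τ x).1 i ≠ (τ y).1 j := by
  constructor
  · rintro (⟨i, x, y, h, h'⟩ | ⟨i, j, -, hb, x, y, h, h'⟩)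
    · exact ⟨i, i, x, y, rfl, h, h'⟩
    · exact ⟨i, j, x, y, hb, h, h'⟩
  · rintro ⟨i, j, x, y, hb, h, h'⟩
    by_cases hij : i = j
    · subst hij
      exact .inl ⟨i, x, y, h, h'⟩
    · exact .inr ⟨i, j, hij, hb, x, y, h, h'⟩

theorem not_inconsistent_lift (σ : Fin n → S → Act) :
    ¬ Inconsistent bind (lift bind σ : ProdPolicy S Act Q m) := by
  rw [inconsistent_iff]
  rintro ⟨i, j, x, y, hb, h, h'⟩
  exact h' (by simp [lift, hb, h])

theorem Factorises.lift_eq {τ : ProdPolicy S Act Q m} {σ : Fin n → S → Act}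
    (h : Factorises bind τ σ) : lift bind σ = τ :=
  funext fun x => Prod.ext (funext fun j => h j x) rfl

theorem exists_resolves [Nonempty Q] (hm : 0 < m) (τ : ProdPolicy S Act Q m) :
    ∃ σ : Fin n → S → Act, Resolves bind τ σ := by
  classical
  obtain ⟨q⟩ := ‹Nonempty Q›
  have : ∀ (v : Fin n) (s : S), ∃ a : Act, (∃ j, bind j = v) →
      ∃ (j : Fin m) (x : ProdState S Q m), bind j = v ∧ x.1 j = s ∧ a = (τ x).1 j := by
    intro v s
    by_cases hv : ∃ j, bind j = v
    · obtain ⟨j, hj⟩ := hv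
      exact ⟨(τ (fun _ => s, q)).1 j, fun _ => ⟨j, _, hj, rfl, rfl⟩⟩
    -- An unbound variable is unconstrained but still needs some action; agent `0` supplies it.
    · exact ⟨(τ (fun _ => s, q)).1 ⟨0, hm⟩, fun h => absurd h hv⟩
  choose σ hσ using this
  exact ⟨σ, hσ⟩

/-- Consistency makes all candidate actions for `σ v s` coincide, so any resolution yields the
factorisation to return. -/
theorem Resolves.factorises {τ : ProdPolicy S Act Q m} {σ : Fin n → S → Act}
    (h : Resolves bind τ σ) (hc : ¬ Inconsistent bind τ) : Factorises bind τ σ := by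
  intro j x
  obtain ⟨k, y, hk, hy, he⟩ := h (bind j) (x.1 j) ⟨j, rfl⟩
  rw [inconsistent_iff] at hc
  push Not at hc
  exact he.trans (hc k j y x hk hy)

/-- The only leaves are atoms, and each names a replica. -/
theorem LTL.pos {AP : Type*} : LTL AP m → 0 < m
  | .atom _ j => j.pos
  | .and φ _ => φ.pos
  | .neg φ => φ.pos
  | .next φ => φ.pos
  | .untl φ _ => φ.pos

end Policies

/-! ### Uniform submodels and their size -/

section Submodels

variable {S Act Q : Type*} {n m : ℕ} {bind : Fin m → Fin n}

/-- The allowed actions of an agent depend only on its local state and its policy variable. -/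
def Submodel.IsUniform (bind : Fin m → Fin n) (D : Submodel S Act Q m) : Prop :=
  ∃ B : Fin n → S → Set Act, ∀ x k, D x k = B (bind k) (x.1 k)

theorem isUniform_fullModel : (fullModel : Submodel S Act Q m).IsUniform bind :=
  ⟨fun _ _ => Set.univ, fun _ _ => rfl⟩

theorem Submodel.IsUniform.modify {D : Submodel S Act Q m} (hD : D.IsUniform bind) (v : Fin n)
    (s : S) (f : Set Act → Set Act) : (D.modify bind v s f).IsUniform bind := by
  classical
  obtain ⟨B, hB⟩ := hD
  refine ⟨fun w r => if w = v ∧ r = s then f (B w r) else B w r, fun x k => ?_⟩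
  simp only [Submodel.modify, hB]

/-- A lifted policy plays `σ v s` at every modified place, so one membership condition suffices. -/
theorem Submodel.IsPolicy.lift_modify {D : Submodel S Act Q m} {σ : Fin n → S → Act}
    (h : D.IsPolicy (lift bind σ)) {v : Fin n} {s : S} {f : Set Act → Set Act}
    (hf : ∀ B, σ v s ∈ B → σ v s ∈ f B) : (D.modify bind v s f).IsPolicy (lift bind σ) := by
  intro x k
  unfold Submodel.modify
  split_ifs with hk
  · have := h x k
    simp only [lift, hk.1, hk.2] at this ⊢
    exact hf _ this
  · exact h x k

variable [Fintype S] [Fintype Q]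

/-- The total number of allowed actions. -/
noncomputable def Submodel.size (D : Submodel S Act Q m) : ℕ :=
  ∑ p : ProdState S Q m × Fin m, (D p.1 p.2).ncard

/-- By uniformity all modified sets equal `D x i`, so none grows and the one at `(x, i)` shrinks. -/
theorem Submodel.IsUniform.size_modify_lt [Finite Act] {D : Submodel S Act Q m}
    (hD : D.IsUniform bind) {x : ProdState S Q m} {i : Fin m} {f : Set Act → Set Act}
    (hf : f (D x i) ⊂ D x i) : (D.modify bind (bind i) (x.1 i) f).size < D.size := by
  obtain ⟨B, hB⟩ := hD
  have hlt : ∀ p : ProdState S Q m × Fin m, bind p.2 = bind i → p.1.1 p.2 = x.1 i →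
      (f (D p.1 p.2)).ncard < (D p.1 p.2).ncard := by
    intro p h1 h2
    have : D p.1 p.2 = D x i := by rw [hB, hB, h1, h2]
    rw [this]
    exact Set.ncard_lt_ncard hf
  refine Finset.sum_lt_sum (fun p _ => ?_) ⟨(x, i), Finset.mem_univ _, ?_⟩
  · unfold Submodel.modify
    split_ifs with h
    · exact (hlt p h.1 h.2).le
    · exact le_rfl
  · simpa [Submodel.modify] using hlt (x, i) rfl rfl

theorem exists_isOptimal [Finite Act] {AP : Type*} (M : MDP S Act (Set AP))
    (A : DRA Q (Fin m → Set AP)) (Φ : Formula S AP n m) {D : Submodel S Act Q m}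
    (h : ∃ τ, D.IsPolicy τ) : ∃ τ, D.IsOptimal M A Φ τ := by
  obtain ⟨τ, hτ, hmax⟩ := Set.exists_max_image {τ | D.IsPolicy τ} (value M A Φ)
    (Set.toFinite _) h
  exact ⟨τ, hτ, hmax⟩

end Submodels

/-! ### Invariant, termination and progress -/

section Algorithm

variable {S Act AP Q : Type*} {n m : ℕ} [Fintype S]

/-- What holds in every configuration of a run: every solution is a policy of some submodel that
is still to be analysed, and results are correct. -/
def Config.Invariant (M : MDP S Act (Set AP)) (A : DRA Q (Fin m → Set AP))
    (Φ : Formula S AP n m) : Config S Act Q n m → Prop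
  | .pending W => (∀ D ∈ W, D.IsUniform Φ.bind) ∧
      ∀ σ, ENNReal.ofReal Φ.threshold < value M A Φ (lift Φ.bind σ) →
        ∃ D ∈ W, D.IsPolicy (lift Φ.bind σ)
  | .found σ => ENNReal.ofReal Φ.threshold < value M A Φ (lift Φ.bind σ)
  | .noSolution => ∀ σ, value M A Φ (lift Φ.bind σ) ≤ ENNReal.ofReal Φ.threshold

variable {M : MDP S Act (Set AP)} {A : DRA Q (Fin m → Set AP)} {Φ : Formula S AP n m}

theorem Config.invariant_initial : (initial : Config S Act Q n m).Invariant M A Φ := by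
  refine ⟨fun D hD => ?_, fun σ _ => ⟨fullModel, Multiset.mem_singleton_self _, fun _ _ => trivial⟩⟩
  rw [Multiset.mem_singleton.1 hD]
  exact isUniform_fullModel

theorem Config.Invariant.discard {W : Multiset (Submodel S Act Q m)} {D : Submodel S Act Q m}
    (h : (Config.pending (D ::ₘ W)).Invariant M A Φ)
    (hD : ∀ τ, D.IsPolicy τ → value M A Φ τ ≤ ENNReal.ofReal Φ.threshold) :
    (Config.pending W).Invariant M A Φ := by
  refine ⟨fun D' hD' => h.1 D' (Multiset.mem_cons_of_mem hD'), fun σ hσ => ?_⟩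
  obtain ⟨D', hD', hp⟩ := h.2 σ hσ
  rcases Multiset.mem_cons.1 hD' with rfl | hD'
  · exact absurd hσ (hD _ hp).not_gt
  · exact ⟨D', hD', hp⟩

theorem Config.Invariant.step {c c' : Config S Act Q n m} (h : c.Invariant M A Φ)
    (hs : Step M A Φ c c') : c'.Invariant M A Φ := by
  cases hs with
  | finish =>
    intro σ
    by_contra! hσ
    obtain ⟨D, hD, -⟩ := h.2 σ hσ
    exact Multiset.notMem_zero D hD
  | discardEmpty hD => exact h.discard fun τ hτ => absurd hτ (hD τ)
  | discard hτ hv => exact h.discard fun τ' hτ' => (hτ.2 τ' hτ').trans hv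
  | factorise hτ hv hc hσ =>
    change _ < _
    rwa [hσ.lift_eq]
  | resolve hτ hv hc hσ hs => exact hs
  | @split W D τ hτ hv hc σ hσ hs i j x y hb hxy a b ha hb' hab =>
    have hD := h.1 D (Multiset.mem_cons_self _ _)
    constructor
    · intro D' hD'
      simp only [Multiset.mem_cons] at hD'
      rcases hD' with rfl | rfl | rfl | hD'
      · exact hD.modify _ _ _
      · exact hD.modify _ _ _
      · exact hD.modify _ _ _
      · exact h.1 D' (Multiset.mem_cons_of_mem hD')
    · intro ρ hρ
      obtain ⟨D', hD', hp⟩ := h.2 ρ hρ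
      rcases Multiset.mem_cons.1 hD' with rfl | hD'
      -- The action `ρ` plays at the split point selects the part that keeps `ρ`.
      · by_cases h1 : ρ (Φ.bind i) (x.1 i) = a
        · exact ⟨_, Multiset.mem_cons_self _ _, hp.lift_modify fun _ _ => h1⟩
        · by_cases h2 : ρ (Φ.bind i) (x.1 i) = b
          · exact ⟨_, Multiset.mem_cons_of_mem (Multiset.mem_cons_self _ _),
              hp.lift_modify fun _ _ => h2⟩
          · refine ⟨_, Multiset.mem_cons_of_mem (Multiset.mem_cons_of_mem
              (Multiset.mem_cons_self _ _)), hp.lift_modify fun _ h => ⟨h, ?_⟩⟩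
            simp [h1, h2]
      · exact ⟨D', by simp [hD'], hp⟩

theorem Reachable.invariant {c : Config S Act Q n m} (h : Reachable M A Φ c) :
    c.Invariant M A Φ := by
  unfold Reachable at h
  induction h with
  | refl => exact Config.invariant_initial
  | tail _ hs ih => exact ih.step hs

/-- A measure that decreases in every step of a run. -/
noncomputable def Config.weight [Fintype Q] : Config S Act Q n m → ℕ
  | .pending W => (W.map fun D => 4 ^ D.size).sum + 1
  | .found _ => 0
  | .noSolution => 0

/-- Each of the three parts of a split has at most a quarter of its parent's weight, so base `4`
suffices; the `+ 1` makes even the empty collection heavier than a result. -/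
theorem Step.weight_lt [Fintype Q] [Finite Act] {c c' : Config S Act Q n m}
    (h : c.Invariant M A Φ) (hs : Step M A Φ c c') : c'.weight < c.weight := by
  cases hs with
  | finish => simp [Config.weight]
  | discardEmpty hD => simp [Config.weight]
  | discard hτ hv => simp [Config.weight]
  | factorise hτ hv hc hσ => simp [Config.weight]
  | resolve hτ hv hc hσ hs => simp [Config.weight]
  | @split W D τ hτ hv hc σ hσ hs i j x y hb hxy a b ha hb' hab =>
    have hD := h.1 D (Multiset.mem_cons_self _ _)
    have haD : a ∈ D x i := ha ▸ hτ.1 x i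
    -- `b` was played at `y` by agent `j`; uniformity transfers it to `x` and `i`, so neither
    -- singleton exhausts `D x i`.
    have hbD : b ∈ D x i := by
      obtain ⟨B, hB⟩ := hD
      have : D x i = D y j := by rw [hB, hB, hb, hxy]
      rw [this, hb']
      exact hτ.1 y j
    have hpow : ∀ f : Set Act → Set Act, f (D x i) ⊂ D x i →
        4 * 4 ^ (D.modify Φ.bind (Φ.bind i) (x.1 i) f).size ≤ 4 ^ D.size := fun f hf => by
      rw [← pow_succ']
      exact Nat.pow_le_pow_right (by norm_num) (hD.size_modify_lt hf)
    have h1 := hpow (fun _ => {a}) ⟨Set.singleton_subset_iff.2 haD, fun h => hab (h hbD).symm⟩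
    have h2 := hpow (fun _ => {b}) ⟨Set.singleton_subset_iff.2 hbD, fun h => hab (h haD)⟩
    have h3 := hpow (fun B => B \ {a, b}) ⟨Set.sdiff_subset, fun h => (h haD).2 (.inl rfl)⟩
    have h4 : 0 < 4 ^ D.size := by positivity
    simp only [Config.weight, Multiset.map_cons, Multiset.sum_cons]
    omega

theorem Step.terminates [Fintype Q] [Finite Act] :
    ¬ ∃ run : ℕ → Config S Act Q n m,
      run 0 = initial ∧ ∀ t, Step M A Φ (run t) (run (t + 1)) := by
  rintro ⟨run, h0, hs⟩
  have hinv : ∀ t, (run t).Invariant M A Φ := by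
    intro t
    induction t with
    | zero => exact h0 ▸ Config.invariant_initial
    | succ t ih => exact ih.step (hs t)
  exact not_strictAnti_of_wellFoundedLT (fun t => (run t).weight)
    (strictAnti_nat_of_succ_lt fun t => (hs t).weight_lt (hinv t))

theorem Step.exists_of_pending [Fintype Q] [Finite Act] (W : Multiset (Submodel S Act Q m)) :
    ∃ c', Step M A Φ (.pending W) c' := by
  have : Nonempty Q := ⟨A.q₀⟩
  induction W using Multiset.induction with
  | empty => exact ⟨_, .finish⟩
  | cons D W _ =>
    by_cases hD : ∃ τ, D.IsPolicy τ
    · obtain ⟨τ, hτ⟩ := exists_isOptimal M A Φ hD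
      obtain ⟨σ, hσ⟩ := exists_resolves (bind := Φ.bind) Φ.body.pos τ
      rcases le_or_gt (value M A Φ τ) (ENNReal.ofReal Φ.threshold) with hv | hv
      · exact ⟨_, .discard hτ hv⟩
      · by_cases hc : Inconsistent Φ.bind τ
        · rcases le_or_gt (value M A Φ (lift Φ.bind σ)) (ENNReal.ofReal Φ.threshold) with hs | hs
          · obtain ⟨i, j, x, y, hb, hxy, hab⟩ := inconsistent_iff.1 hc
            exact ⟨_, .split hτ hv hc hσ hs hb hxy rfl rfl hab⟩
          · exact ⟨_, .resolve hτ hv hc hσ hs⟩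
        · exact ⟨_, .factorise hτ hv hc (hσ.factorises hc)⟩
    · exact ⟨_, .discardEmpty (not_exists.1 hD)⟩

end Algorithm

end PHLTL

theorem mainTheorem4 {S Act AP Q : Type*} [Fintype S] [Fintype Act] [Fintype AP] [Fintype Q]
    {n m : ℕ} (M : MDP S Act (Set AP)) (Φ : Formula S AP n m)
    (A : DRA Q (Fin m → Set AP)) (hA : ∀ w, A.Accepts w ↔ Φ.body.Sat w) :
    -- every run terminates
    (¬ ∃ run : ℕ → Config S Act Q n m,
      run 0 = initial ∧ ∀ t, Step M A Φ (run t) (run (t + 1))) ∧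
    -- a run only ever stops with a correct result
    (∀ c : Config S Act Q n m, Reachable M A Φ c → (∀ c', ¬ Step M A Φ c c') →
      (∃ σ : Fin n → S → Act, c = .found σ ∧
        ¬ Inconsistent Φ.bind (lift Φ.bind σ : ProdPolicy S Act Q m) ∧ Φ.Witness M σ) ∨
      (c = .noSolution ∧ ¬ ∃ σ : Fin n → S → Act, Φ.Witness M σ)) := by
  refine ⟨Step.terminates, fun c hc hstuck => ?_⟩
  have hinv := hc.invariant
  cases c with
  | pending W =>
    obtain ⟨c', h⟩ := Step.exists_of_pending (M := M) (A := A) (Φ := Φ) W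
    exact absurd h (hstuck c')
  | found σ =>
    exact .inl ⟨σ, rfl, not_inconsistent_lift σ, (lt_value_lift_iff_witness M Φ A hA σ).1 hinv⟩
  | noSolution =>
    refine .inr ⟨rfl, ?_⟩
    rintro ⟨σ, hσ⟩
    exact (hinv σ).not_gt ((lt_value_lift_iff_witness M Φ A hA σ).2 hσ)
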